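/- There is a universal constant $\mathcal C>0$ such that the following holds. Let $m,d,T\ge 1$ be integers, let $0<\delta<1$, and let $U_1,\dots,U_{T+d-1}$ be i.i.d. random vectors in $\mathbb R^m$ that are isotropic, $\mathbb E[U_tU_t^\top]=I_m$, and sub-Gaussian with parameter $1$, i.e. $\mathbb E[e^{\lambda\langle v,U_t\rangle}]\le e^{\lambda^2/2}$ for all $\lambda\in\mathbb R$ and all unit vectors $v\in\mathbb R^m$. For $0\le l\le T-1$ let $$\tilde U^-_{l+d,d}=\begin{bmatrix}U_{l+d}\\ U_{l+d-1}\\ \vdots\\ U_{l+1}\end{bmatrix}\in\mathbb R^{md},\qquad V_T=\sum_{l=0}^{T-1}\tilde U^-_{l+d,d}\,(\tilde U^-_{l+d,d})^\top ,$$ and put $$T_0(\delta,d)=\mathcal C\,md\Big(d\log\frac{2}{\delta}+2\log\frac{8dm}{\delta}\Big).$$ If $T>T_0(\delta,d)$, then with probability at least $1-\delta$ $$\tfrac12\,T\,I\preceq V_T\preceq \tfrac32\,T\,I,$$ where $\preceq$ is the positive semidefinite (Loewner) order. -/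

import Mathlib

open MeasureTheory ProbabilityTheory

noncomputable section

/-- A random vector is isotropic if its second moment matrix `E[X Xᵀ]` is the identity. -/
def IsIsotropic {Ω : Type*} [MeasurableSpace Ω] (μ : Measure Ω) {m : ℕ}
    (X : Ω → EuclideanSpace ℝ (Fin m)) : Prop :=
  Matrix.of (fun i j : Fin m => ∫ ω, X ω i * X ω j ∂μ) = 1

/-- A random vector is sub-Gaussian with parameter `1` if every one-dimensional marginal
`⟪v, X⟫` along a unit vector `v` satisfies `E[exp (t ⟪v, X⟫)] ≤ exp (t ^ 2 / 2)` for all real `t`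
(with these exponential moments finite). -/
def IsSubGaussianOne {Ω : Type*} [MeasurableSpace Ω] (μ : Measure Ω) {m : ℕ}
    (X : Ω → EuclideanSpace ℝ (Fin m)) : Prop :=
  ∀ v : EuclideanSpace ℝ (Fin m), ‖v‖ = 1 →
    HasSubgaussianMGF (fun ω => inner ℝ v (X ω)) 1 μ

/-- The stacked vector of past inputs `(u l, u (l - 1), …, u (l - d + 1))`; the entry `(i, a)` is
coordinate `a` of block `i`. It is only used for `d ≤ l`, so the subtraction never truncates. -/
def stackedPast {m : ℕ} (u : ℕ → EuclideanSpace ℝ (Fin m)) (l d : ℕ) : Fin d × Fin m → ℝ :=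
  fun p => u (l - (p.1 : ℕ)) p.2

/-- The sample covariance matrix: the sum over `0 ≤ l < T` of the outer products of the stacked
vectors `(u (l + d), …, u (l + 1))` with themselves. -/
def sampleCov {m : ℕ} (u : ℕ → EuclideanSpace ℝ (Fin m)) (d T : ℕ) :
    Matrix (Fin d × Fin m) (Fin d × Fin m) ℝ :=
  ∑ l ∈ Finset.range T,
    Matrix.vecMulVec (stackedPast u (l + d) d) (stackedPast u (l + d) d)

/-- The threshold `C m d (d log (2 / δ) + 2 log (8 d m / δ))` on the number of samples. -/
def sampleThreshold (C : ℝ) (m d : ℕ) (δ : ℝ) : ℝ :=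
  C * m * d * (d * Real.log (2 / δ) + 2 * Real.log (8 * d * m / δ))

end

/-! For a fixed unit vector `x`, the projection of each stacked vector on `x` is sub-Gaussian with
parameter 1 and second moment 1. Overlapping stacked vectors are dependent, but windows whose
starting indices agree mod `d` are disjoint. Within one residue class the projections are therefore
independent, and a Chernoff bound for the sum of `Z ^ 2 - 1` makes a deviation of 1/64 of the class
size exponentially unlikely (`measureReal_card_div_le_abs_sum_sq_sub_one_le`,
`measureReal_residue_class_le`).

A union bound over the `d` classes and a 1/2-net of at most `5 ^ (d * m)` unit vectors costs a
factor that the threshold absorbs (`card_mul_exp_le_of_sampleThreshold_lt`). Off the bad event the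
form of `V_T - T I` is at most `T / 64` on the net, hence at most `32 * T / 64 = T / 2` on the whole
sphere (`abs_dotProduct_mulVec_le_of_half_net`). -/

/-! ### Exponential moments of squares of sub-Gaussian variables -/

theorem integral_exp_sq_div_four_gaussianReal :
    Integrable (fun x : ℝ => Real.exp (x ^ 2 / 4)) (gaussianReal 0 1) ∧
      ∫ x, Real.exp (x ^ 2 / 4) ∂(gaussianReal 0 1) = √2 := by
  have key : ∀ x : ℝ, gaussianPDFReal 0 1 x • Real.exp (x ^ 2 / 4)
      = (√(2 * Real.pi))⁻¹ * Real.exp (-(1 / 4) * x ^ 2) := by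
    intro x
    simp only [gaussianPDFReal, smul_eq_mul, NNReal.coe_one, mul_one, sub_zero, mul_assoc,
      ← Real.exp_add]
    congr 2
    ring
  constructor
  · rw [gaussianReal_of_var_ne_zero 0 one_ne_zero, gaussianPDF_def,
      integrable_withDensity_iff_integrable_smul' (by fun_prop) (by simp)]
    simp only [ENNReal.toReal_ofReal (gaussianPDFReal_nonneg 0 1 _), key]
    exact (integrable_exp_neg_mul_sq (by norm_num)).const_mul _
  · rw [integral_gaussianReal_eq_integral_smul one_ne_zero]
    simp only [key]
    rw [integral_const_mul, integral_gaussian, ← Real.sqrt_inv, ← Real.sqrt_mul (by positivity)]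
    congr 1
    have := Real.pi_pos
    field_simp
    norm_num

section
variable {Ω : Type*} [MeasurableSpace Ω] {μ : Measure Ω}

/-- Gaussian linearization: `exp (z ^ 2 / 4)` is the mean of `exp (z * g / √2)` over a standard
normal `g`. After Tonelli, the sub-Gaussian bound in `Z` for fixed `g` leaves the Gaussian integral
of `exp (g ^ 2 / 4)`. -/
theorem ProbabilityTheory.HasSubgaussianMGF.lintegral_exp_sq_div_four_le [IsProbabilityMeasure μ]
    {Z : Ω → ℝ} (h : HasSubgaussianMGF Z 1 μ) :
    ∫⁻ ω, ENNReal.ofReal (Real.exp (Z ω ^ 2 / 4)) ∂μ ≤ ENNReal.ofReal √2 := by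
  have hint : ∀ t : ℝ, Integrable (fun x => Real.exp (t * x)) (gaussianReal 0 1) :=
    fun t => integrable_exp_mul_gaussianReal t
  have hpt : ∀ ω, ENNReal.ofReal (Real.exp (Z ω ^ 2 / 4)) =
      ∫⁻ x, ENNReal.ofReal (Real.exp (√(1 / 2) * Z ω * x)) ∂(gaussianReal 0 1) := by
    intro ω
    rw [← ofReal_integral_eq_lintegral_ofReal (hint _) (ae_of_all _ fun _ => (Real.exp_pos _).le)]
    have := congrFun (mgf_id_gaussianReal (μ := 0) (v := 1)) (√(1 / 2) * Z ω)
    simp only [mgf, id] at this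
    rw [this, mul_pow, Real.sq_sqrt (by norm_num)]
    congr 2
    simp
    ring
  simp_rw [hpt]
  rw [lintegral_lintegral_swap]
  · calc ∫⁻ x, ∫⁻ ω, ENNReal.ofReal (Real.exp (√(1 / 2) * Z ω * x)) ∂μ ∂(gaussianReal 0 1)
        ≤ ∫⁻ x, ENNReal.ofReal (Real.exp (x ^ 2 / 4)) ∂(gaussianReal 0 1) := by
          refine lintegral_mono fun x => ?_
          have h1 := h.integrable_exp_mul (√(1 / 2) * x)
          have h2 := h.mgf_le (√(1 / 2) * x)
          have h3 : ∀ ω, √(1 / 2) * Z ω * x = √(1 / 2) * x * Z ω := fun ω => by ring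
          simp_rw [h3]
          rw [← ofReal_integral_eq_lintegral_ofReal h1 (ae_of_all _ fun _ => (Real.exp_pos _).le)]
          refine ENNReal.ofReal_le_ofReal (h2.trans_eq ?_)
          rw [mul_pow, Real.sq_sqrt (by norm_num)]
          congr 1
          simp
          ring
      _ = ENNReal.ofReal √2 := by
          rw [← ofReal_integral_eq_lintegral_ofReal integral_exp_sq_div_four_gaussianReal.1
            (ae_of_all _ fun _ => (Real.exp_pos _).le), integral_exp_sq_div_four_gaussianReal.2]
  · have := h.aemeasurable
    refine (ENNReal.measurable_ofReal.comp Real.measurable_exp).comp_aemeasurable ?_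
    exact ((this.comp_fst).const_mul _).mul measurable_snd.aemeasurable

theorem ProbabilityTheory.HasSubgaussianMGF.integrable_exp_sq_div_four [IsProbabilityMeasure μ]
    {Z : Ω → ℝ} (h : HasSubgaussianMGF Z 1 μ) :
    Integrable (fun ω => Real.exp (Z ω ^ 2 / 4)) μ := by
  refine ⟨(Real.measurable_exp.comp_aemeasurable
    ((h.aemeasurable.pow_const 2).div_const 4)).aestronglyMeasurable, ?_⟩
  rw [hasFiniteIntegral_iff_ofReal (ae_of_all _ fun _ => (Real.exp_pos _).le)]
  exact h.lintegral_exp_sq_div_four_le.trans_lt ENNReal.ofReal_lt_top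

theorem ProbabilityTheory.HasSubgaussianMGF.integral_exp_sq_div_four_le [IsProbabilityMeasure μ]
    {Z : Ω → ℝ} (h : HasSubgaussianMGF Z 1 μ) :
    ∫ ω, Real.exp (Z ω ^ 2 / 4) ∂μ ≤ √2 := by
  have h1 := h.lintegral_exp_sq_div_four_le
  rwa [← ofReal_integral_eq_lintegral_ofReal h.integrable_exp_sq_div_four
    (ae_of_all _ fun _ => (Real.exp_pos _).le),
    ENNReal.ofReal_le_ofReal_iff (Real.sqrt_nonneg _)] at h1

theorem Real.exp_le_one_add_add_sq_mul_exp_abs (t : ℝ) :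
    Real.exp t ≤ 1 + t + t ^ 2 * Real.exp |t| := by
  have h := Complex.norm_exp_sub_sum_le_norm_mul_exp (t : ℂ) 2
  simp only [Finset.sum_range_succ, Finset.sum_range_zero] at h
  have h2 : Complex.exp t - (0 + (t : ℂ) ^ 0 / (Nat.factorial 0 : ℕ)
      + (t : ℂ) ^ 1 / (Nat.factorial 1 : ℕ)) = ((Real.exp t - (1 + t) : ℝ) : ℂ) := by
    push_cast
    simp
  rw [h2, Complex.norm_real, Complex.norm_real, Real.norm_eq_abs, Real.norm_eq_abs, sq_abs] at h
  linarith [le_abs_self (Real.exp t - (1 + t))]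

theorem Real.exp_mul_sq_sub_one_le {a : ℝ} (ha : |a| ≤ 1 / 8) (z : ℝ) :
    Real.exp (a * (z ^ 2 - 1)) ≤
      1 + a * (z ^ 2 - 1) + 128 * Real.exp (1 / 4) * a ^ 2 * Real.exp (z ^ 2 / 4) := by
  refine (Real.exp_le_one_add_add_sq_mul_exp_abs _).trans ?_
  have hw : |z ^ 2 - 1| ≤ z ^ 2 + 1 := by
    rw [abs_le]; constructor <;> nlinarith [sq_nonneg z]
  set w := |z ^ 2 - 1| with hwdef
  have hw0 : 0 ≤ w := abs_nonneg _
  -- From `s ^ 2 / 2 ≤ exp s` at `s = w / 8`. This factor and `exp (|a| * w)` each use half of the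
  -- available `exp (w / 4)`.
  have h1 : w ^ 2 ≤ 128 * Real.exp (w / 8) := by
    have := Real.quadratic_le_exp_of_nonneg (x := w / 8) (by positivity)
    nlinarith
  have h2 : Real.exp |a * (z ^ 2 - 1)| ≤ Real.exp (w / 8) := by
    rw [abs_mul]
    exact Real.exp_le_exp.2 (by nlinarith)
  have h3 : Real.exp (w / 8) * Real.exp (w / 8) ≤ Real.exp (1 / 4) * Real.exp (z ^ 2 / 4) := by
    rw [← Real.exp_add, ← Real.exp_add]
    exact Real.exp_le_exp.2 (by linarith)
  have h4 : (a * (z ^ 2 - 1)) ^ 2 = a ^ 2 * w ^ 2 := by rw [mul_pow, hwdef, sq_abs]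
  rw [h4]
  have h5 : w ^ 2 * Real.exp |a * (z ^ 2 - 1)| ≤
      128 * (Real.exp (1 / 4) * Real.exp (z ^ 2 / 4)) := by
    calc w ^ 2 * Real.exp |a * (z ^ 2 - 1)| ≤ 128 * Real.exp (w / 8) * Real.exp (w / 8) := by
          gcongr
      _ ≤ _ := by linarith
  nlinarith [mul_le_mul_of_nonneg_left h5 (sq_nonneg a)]

theorem ProbabilityTheory.HasSubgaussianMGF.integrable_exp_mul_sq_sub_one
    [IsProbabilityMeasure μ] {Z : Ω → ℝ} (h : HasSubgaussianMGF Z 1 μ) {a : ℝ} (ha : |a| ≤ 1 / 8) :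
    Integrable (fun ω => Real.exp (a * (Z ω ^ 2 - 1))) μ := by
  refine (h.integrable_exp_sq_div_four.const_mul (Real.exp (1 / 8))).mono'
    (Real.measurable_exp.comp_aemeasurable
    (((h.aemeasurable.pow_const 2).sub_const 1).const_mul a)).aestronglyMeasurable
    (ae_of_all _ fun ω => ?_)
  rw [Real.norm_eq_abs, Real.abs_exp, ← Real.exp_add]
  have := abs_le.1 ha
  exact Real.exp_le_exp.2 (by nlinarith [sq_nonneg (Z ω)])

/-- The linear term of the expansion has mean zero, so only the quadratic remainder survives; 256 is
`128 * (4 / 3) * (3 / 2)`. -/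
theorem ProbabilityTheory.HasSubgaussianMGF.mgf_sq_sub_one_le
    [IsProbabilityMeasure μ] {Z : Ω → ℝ} (h : HasSubgaussianMGF Z 1 μ)
    (hZ : ∫ ω, Z ω ^ 2 ∂μ = 1) {a : ℝ} (ha : |a| ≤ 1 / 8) :
    mgf (fun ω => Z ω ^ 2 - 1) μ a ≤ Real.exp (256 * a ^ 2) := by
  have hsq : Integrable (fun ω => Z ω ^ 2) μ := (h.memLp 2).integrable_sq
  have i1 : Integrable (fun ω => a * (Z ω ^ 2 - 1)) μ :=
    (hsq.sub (integrable_const 1)).const_mul a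
  have i2 : Integrable (fun ω => 1 + a * (Z ω ^ 2 - 1)) μ := (integrable_const 1).add i1
  have i3 := h.integrable_exp_sq_div_four.const_mul (128 * Real.exp (1 / 4) * a ^ 2)
  calc mgf (fun ω => Z ω ^ 2 - 1) μ a
      ≤ ∫ ω, (1 + a * (Z ω ^ 2 - 1) +
          128 * Real.exp (1 / 4) * a ^ 2 * Real.exp (Z ω ^ 2 / 4)) ∂μ :=
        integral_mono (h.integrable_exp_mul_sq_sub_one ha) (i2.add i3)
          fun ω => Real.exp_mul_sq_sub_one_le ha (Z ω)
    _ = 1 + 128 * Real.exp (1 / 4) * a ^ 2 * ∫ ω, Real.exp (Z ω ^ 2 / 4) ∂μ := by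
        rw [integral_add i2 i3, integral_add (integrable_const 1) i1, integral_const_mul,
          integral_const_mul, integral_sub hsq (integrable_const 1), hZ]
        simp
    _ ≤ 1 + 256 * a ^ 2 := by
        have h1 := h.integral_exp_sq_div_four_le
        have h2 : Real.exp (1 / 4) ≤ 4 / 3 := by
          have := Real.exp_bound_div_one_sub_of_interval (x := 1 / 4) (by norm_num) (by norm_num)
          norm_num at this ⊢
          linarith
        have h3 : √2 ≤ 3 / 2 := by rw [Real.sqrt_le_left (by norm_num)]; norm_num
        have h0 : 0 ≤ ∫ ω, Real.exp (Z ω ^ 2 / 4) ∂μ :=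
          integral_nonneg fun _ => (Real.exp_pos _).le
        have h4 : Real.exp (1 / 4) * ∫ ω, Real.exp (Z ω ^ 2 / 4) ∂μ ≤ 4 / 3 * (3 / 2) :=
          mul_le_mul h2 (h1.trans h3) h0 (by norm_num)
        nlinarith [mul_le_mul_of_nonneg_left h4 (sq_nonneg a)]
    _ ≤ _ := by linarith [Real.add_one_le_exp (256 * a ^ 2)]

/-- By Jensen, the mean `e` satisfies `t * e ≤ c * t ^ 2 / 2` for all `t`; a small `t` of the sign
of `e` forces `e = 0`. Taking `t = e / (c + 1)` also covers `c = 0`. -/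
theorem ProbabilityTheory.HasSubgaussianMGF.integral_eq_zero
    [IsProbabilityMeasure μ] {Z : Ω → ℝ} {c : NNReal} (h : HasSubgaussianMGF Z c μ) :
    ∫ ω, Z ω ∂μ = 0 := by
  have key : ∀ t : ℝ, t * ∫ ω, Z ω ∂μ ≤ c * t ^ 2 / 2 := by
    intro t
    rw [← Real.exp_le_exp, ← integral_const_mul]
    refine le_trans ?_ (h.mgf_le t)
    exact convexOn_exp.map_integral_le Real.continuous_exp.continuousOn isClosed_univ (by simp)
      (h.integrable.const_mul t) (h.integrable_exp_mul t)
  set e := ∫ ω, Z ω ∂μ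
  have hc : (0 : ℝ) ≤ c := c.2
  have h1 := key (e / (c + 1))
  have h2 : (c : ℝ) * (e / (c + 1)) ^ 2 / 2 ≤ e ^ 2 / (c + 1) / 2 := by
    rw [div_pow]
    have : (c : ℝ) * (e ^ 2 / (c + 1) ^ 2) ≤ e ^ 2 / (c + 1) := by
      rw [mul_div_assoc', div_le_div_iff₀ (by positivity) (by positivity)]
      nlinarith [mul_nonneg (sq_nonneg e) (by positivity : (0 : ℝ) ≤ c + 1)]
    linarith
  have h3 : e / (c + 1) * e = e ^ 2 / (c + 1) := by ring
  have h4 : e ^ 2 / (c + 1 : ℝ) ≤ 0 := by linarith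
  have h5 : e ^ 2 ≤ 0 := by
    by_contra hcon
    exact absurd h4 (not_le.2 (div_pos (not_le.1 hcon) (by positivity)))
  exact pow_eq_zero_iff (two_ne_zero) |>.1 (le_antisymm h5 (sq_nonneg e))

end

/-! ### Nets on the sphere and quadratic forms -/

/-- A 1/2-separated subset of the sphere of maximal cardinality is a net. Doubling it gives
1-separated points of norm 2, to which the Besicovitch volume count applies. -/
theorem exists_half_net_sphere (E : Type*) [NormedAddCommGroup E] [NormedSpace ℝ E]
    [FiniteDimensional ℝ E] :
    ∃ N : Finset E, (∀ x ∈ N, ‖x‖ = 1) ∧ N.card ≤ 5 ^ Module.finrank ℝ E ∧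
      ∀ y : E, ‖y‖ = 1 → ∃ x ∈ N, ‖y - x‖ ≤ 1 / 2 := by
  classical
  let P : Finset E → Prop := fun s => (∀ x ∈ s, ‖x‖ = 1) ∧
    ∀ x ∈ s, ∀ y ∈ s, x ≠ y → 1 / 2 ≤ ‖x - y‖
  have hP : ∀ s, P s → s.card ≤ 5 ^ Module.finrank ℝ E := by
    rintro s ⟨h1, h2⟩
    have hinj : Function.Injective (fun x : E => (2 : ℝ) • x) := smul_right_injective E two_ne_zero
    rw [← Finset.card_image_of_injective s hinj]
    refine Besicovitch.card_le_of_separated _ ?_ ?_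
    · simp only [Finset.mem_image]
      rintro _ ⟨x, hx, rfl⟩
      rw [norm_smul, h1 x hx]; norm_num
    · simp only [Finset.mem_image]
      rintro _ ⟨x, hx, rfl⟩ _ ⟨y, hy, rfl⟩ hxy
      rw [← smul_sub, norm_smul, Real.norm_eq_abs, abs_two]
      have := h2 x hx y hy (fun h => hxy (by rw [h]))
      linarith
  let Q : ℕ → Prop := fun n => ∃ s, P s ∧ s.card = n
  have h0 : Q 0 := ⟨∅, ⟨by simp, by simp⟩, rfl⟩
  obtain ⟨N, hN, hcard⟩ : Q (Nat.findGreatest Q (5 ^ Module.finrank ℝ E)) :=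
    Nat.findGreatest_spec (Nat.zero_le _) h0
  refine ⟨N, hN.1, hP N hN, fun y hy => ?_⟩
  by_contra! hcon
  have hyN : y ∉ N := fun h => by
    have := hcon y h
    simp at this
    linarith
  have hins : P (insert y N) := by
    refine ⟨?_, ?_⟩
    · simp only [Finset.mem_insert]
      rintro x (rfl | hx)
      exacts [hy, hN.1 x hx]
    · simp only [Finset.mem_insert]
      rintro x (rfl | hx) z (rfl | hz) hxz
      · exact absurd rfl hxz
      · exact (hcon z hz).le
      · rw [norm_sub_rev]; exact (hcon x hx).le
      · exact hN.2 x hx z hz hxz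
  have := Nat.le_findGreatest (P := Q) (hP _ hins) ⟨_, hins, rfl⟩
  rw [Finset.card_insert_of_notMem hyN, ← hcard] at this
  omega

/-- At a maximizer `z` of `|q|` on the sphere with a nearby net point `x`, polarization gives `|q z
- q x| ≤ 31 / 32 * |q z|`, so `|q z| ≤ 32 * |q x|`. Only values of `q` enter, so `A` need not be
symmetric. -/
theorem abs_dotProduct_mulVec_le_of_half_net {ι : Type*} [Fintype ι] (A : Matrix ι ι ℝ)
    (N : Finset (EuclideanSpace ℝ ι)) (hN : ∀ x ∈ N, ‖x‖ = 1)
    (hnet : ∀ y : EuclideanSpace ℝ ι, ‖y‖ = 1 → ∃ x ∈ N, ‖y - x‖ ≤ 1 / 2) {τ : ℝ}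
    (hτ : ∀ x ∈ N, |x.ofLp ⬝ᵥ A.mulVec x.ofLp| ≤ τ) (y : EuclideanSpace ℝ ι) :
    |y.ofLp ⬝ᵥ A.mulVec y.ofLp| ≤ 32 * τ * ‖y‖ ^ 2 := by
  set q : EuclideanSpace ℝ ι → ℝ := fun y => y.ofLp ⬝ᵥ A.mulVec y.ofLp with hq
  have hsmul : ∀ (c : ℝ) y, q (c • y) = c ^ 2 * q y := by
    intro c y
    simp only [hq, WithLp.ofLp_smul, Matrix.mulVec_smul, dotProduct_smul, smul_dotProduct,
      smul_eq_mul]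
    ring
  -- Polarization of the pair `(y + x) / 2`, `2 (y - x)`, rescaled so that both have norm at most 1
  -- when `‖y - x‖ ≤ 1 / 2` on the sphere.
  have hpol : ∀ x y, q y - q x =
      (q ((5 / 2 : ℝ) • y - (3 / 2 : ℝ) • x) - q ((3 / 2 : ℝ) • y - (5 / 2 : ℝ) • x)) / 4 := by
    intro x y
    simp only [hq, WithLp.ofLp_smul, WithLp.ofLp_sub, Matrix.mulVec_smul, Matrix.mulVec_sub,
      dotProduct_smul, smul_dotProduct, dotProduct_sub, sub_dotProduct, smul_eq_mul]
    ring
  have hcont : Continuous q := by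
    simp only [hq]
    fun_prop
  rcases eq_or_ne y 0 with rfl | hy0
  · simp
  have hscale : ∀ {M : ℝ}, (∀ u : EuclideanSpace ℝ ι, ‖u‖ = 1 → |q u| ≤ M) → ∀ v,
      |q v| ≤ M * ‖v‖ ^ 2 := by
    intro M hM v
    rcases eq_or_ne v 0 with rfl | hv
    · simp [hq]
    have hv' : ‖v‖ ≠ 0 := norm_ne_zero_iff.2 hv
    have h1 := hM (‖v‖⁻¹ • v) (by rw [norm_smul, norm_inv, norm_norm, inv_mul_cancel₀ hv'])
    rw [hsmul, abs_mul, abs_of_nonneg (sq_nonneg _), inv_pow] at h1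
    rwa [inv_mul_le_iff₀ (by positivity), mul_comm] at h1
  refine hscale ?_ y
  have hne : (Metric.sphere (0 : EuclideanSpace ℝ ι) 1).Nonempty := by
    refine ⟨‖y‖⁻¹ • y, ?_⟩
    rw [mem_sphere_zero_iff_norm, norm_smul, norm_inv, norm_norm,
      inv_mul_cancel₀ (norm_ne_zero_iff.2 hy0)]
  obtain ⟨z, hz, hmax⟩ := (isCompact_sphere (0 : EuclideanSpace ℝ ι) 1).exists_isMaxOn hne
    hcont.abs.continuousOn
  rw [mem_sphere_zero_iff_norm] at hz
  have hM : ∀ u : EuclideanSpace ℝ ι, ‖u‖ = 1 → |q u| ≤ |q z| := fun u hu =>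
    hmax (mem_sphere_zero_iff_norm.2 hu)
  obtain ⟨x, hxN, hx⟩ := hnet z hz
  have hx1 := hN x hxN
  have n0 := norm_sub_sq_real z x
  have n1 := norm_sub_sq_real ((5 / 2 : ℝ) • z) ((3 / 2 : ℝ) • x)
  have n2 := norm_sub_sq_real ((3 / 2 : ℝ) • z) ((5 / 2 : ℝ) • x)
  simp only [norm_smul, inner_smul_left, inner_smul_right, hz, hx1] at n0 n1 n2
  have b1 := hscale hM ((5 / 2 : ℝ) • z - (3 / 2 : ℝ) • x)
  have b2 := hscale hM ((3 / 2 : ℝ) • z - (5 / 2 : ℝ) • x)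
  rw [n1] at b1
  rw [n2] at b2
  norm_num at b1 b2 n0
  have hsq : ‖z - x‖ ^ 2 ≤ 1 / 4 := by nlinarith [norm_nonneg (z - x)]
  have hin : 7 / 8 ≤ inner ℝ z x := by linarith
  -- Both arguments have squared norm `17 / 2 - 15 / 2 * inner ℝ z x`, at most `31 / 16`.
  have hzx : |q z - q x| ≤ 31 / 32 * |q z| := by
    rw [hpol x z, abs_div, abs_of_pos (by norm_num : (0 : ℝ) < 4)]
    have := abs_sub (q ((5 / 2 : ℝ) • z - (3 / 2 : ℝ) • x)) (q ((3 / 2 : ℝ) • z - (5 / 2 : ℝ) • x))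
    nlinarith [abs_nonneg (q z)]
  have hqx := hτ x hxN
  have := abs_sub_abs_le_abs_sub (q z) (q x)
  intro u hu
  have := hM u hu
  change |q x| ≤ τ at hqx
  linarith

/-! ### Concentration for sums over independent blocks -/

section
variable {Ω ι κ : Type*} [MeasurableSpace Ω] {μ : Measure Ω}

theorem ProbabilityTheory.iIndepFun.mgf_sum_comp_sum [Fintype ι] {W : κ → ι → Ω → ℝ}
    (h : iIndepFun (fun p : κ × ι => W p.1 p.2) μ) (hW : ∀ k i, AEMeasurable (W k i) μ)
    {g : ℝ → ℝ} (hg : Measurable g) (s : Finset κ) (t : ℝ) :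
    mgf (fun ω => ∑ k ∈ s, g (∑ i, W k i ω)) μ t =
      ∏ k ∈ s, mgf (fun ω => g (∑ i, W k i ω)) μ t := by
  classical
  have := h.isProbabilityMeasure
  have hmeas : ∀ k, AEMeasurable (fun ω => g (∑ i, W k i ω)) μ := fun k =>
    hg.comp_aemeasurable (Finset.aemeasurable_fun_sum _ fun i _ => hW k i)
  induction s using Finset.induction_on with
  | empty => simp
  | insert a s ha ih =>
    simp only [Finset.sum_insert ha, Finset.prod_insert ha]
    rw [← ih]
    have hdisj : Disjoint (({a} : Finset κ) ×ˢ (Finset.univ : Finset ι)) (s ×ˢ Finset.univ) := by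
      rw [Finset.disjoint_product]
      exact Or.inl (Finset.disjoint_singleton_left.2 ha)
    have hI := h.indepFun_finset₀ _ _ hdisj (fun p => hW p.1 p.2)
    have hφ : Measurable (fun v : (({a} : Finset κ) ×ˢ (Finset.univ : Finset ι) : Finset (κ × ι)) → ℝ =>
        g (∑ i, v ⟨(a, i), by simp⟩)) :=
      hg.comp (Finset.measurable_sum _ fun i _ => measurable_pi_apply _)
    have hψ : Measurable (fun v : (s ×ˢ (Finset.univ : Finset ι) : Finset (κ × ι)) → ℝ =>
        ∑ k ∈ s.attach, g (∑ i, v ⟨(k.1, i), by simp⟩)) :=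
      Finset.measurable_sum _ fun k _ =>
        hg.comp (Finset.measurable_sum _ fun i _ => measurable_pi_apply _)
    have hI' := hI.comp hφ hψ
    have hsum : ∀ ω, ∑ k ∈ s.attach, g (∑ i, W k.1 i ω) = ∑ k ∈ s, g (∑ i, W k i ω) := fun ω =>
      Finset.sum_attach s (fun k => g (∑ i, W k i ω))
    simp only [Function.comp_def, hsum] at hI'
    exact hI'.mgf_add' (hmeas a).aestronglyMeasurable
      (Finset.aemeasurable_fun_sum _ fun k _ => hmeas k).aestronglyMeasurable

theorem ProbabilityTheory.iIndepFun.integral_sq_sum [Fintype ι] {X : ι → Ω → ℝ} {c : ι → NNReal}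
    (h : iIndepFun X μ) (hX : ∀ i, HasSubgaussianMGF (X i) (c i) μ) :
    ∫ ω, (∑ i, X i ω) ^ 2 ∂μ = ∑ i, ∫ ω, X i ω ^ 2 ∂μ := by
  have := h.isProbabilityMeasure
  have hsum := HasSubgaussianMGF.sum_of_iIndepFun h (s := Finset.univ) fun i _ => hX i
  rw [← variance_of_integral_eq_zero hsum.aemeasurable hsum.integral_eq_zero]
  have hv := IndepFun.variance_sum (s := Finset.univ) (fun i _ => (hX i).memLp 2)
    (fun i _ j _ hij => h.indepFun hij)
  rw [← Finset.sum_fn, hv]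
  exact Finset.sum_congr rfl fun i _ =>
    variance_of_integral_eq_zero (hX i).aemeasurable (hX i).integral_eq_zero

theorem measureReal_card_div_le_abs_sum_sq_sub_one_le [Fintype ι] [Fintype κ]
    [IsProbabilityMeasure μ]
    {W : κ → ι → Ω → ℝ} {c : ι → NNReal} (h : iIndepFun (fun p : κ × ι => W p.1 p.2) μ)
    (hW : ∀ k i, HasSubgaussianMGF (W k i) (c i) μ) (hW2 : ∀ k i, ∫ ω, W k i ω ^ 2 ∂μ = c i)
    (hc : ∑ i, c i = 1) :
    μ.real {ω | (Fintype.card κ : ℝ) / 64 ≤ |∑ k, ((∑ i, W k i ω) ^ 2 - 1)|} ≤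
      2 * Real.exp (-(Fintype.card κ / 2 ^ 22)) := by
  have hk : ∀ k, iIndepFun (W k) μ := fun k =>
    h.precomp (g := fun i => (k, i)) fun i j hij => congrArg Prod.snd hij
  have hZ : ∀ k, HasSubgaussianMGF (fun ω => ∑ i, W k i ω) 1 μ := fun k =>
    hc ▸ HasSubgaussianMGF.sum_of_iIndepFun (hk k) fun i _ => hW k i
  have hZ2 : ∀ k, ∫ ω, (∑ i, W k i ω) ^ 2 ∂μ = 1 := fun k => by
    rw [(hk k).integral_sq_sum (hW k), Finset.sum_congr rfl fun i _ => hW2 k i]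
    exact_mod_cast hc
  set S : Ω → ℝ := fun ω => ∑ k, ((∑ i, W k i ω) ^ 2 - 1) with hS
  have hmgf : ∀ a : ℝ, |a| ≤ 1 / 8 → mgf S μ a ≤ Real.exp (256 * a ^ 2 * Fintype.card κ) := by
    intro a ha
    rw [hS, h.mgf_sum_comp_sum (fun k i => (hW k i).aemeasurable) (g := fun z => z ^ 2 - 1)
      (by fun_prop) Finset.univ a]
    refine (Finset.prod_le_prod (fun _ _ => mgf_nonneg)
      fun k _ => (hZ k).mgf_sq_sub_one_le (hZ2 k) ha).trans_eq ?_
    rw [Finset.prod_const, ← Real.exp_nat_mul, Finset.card_univ]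
    congr 1
    ring
  -- Without integrability the mgf would take its default value 0, yet it equals a product of
  -- positive factors.
  have hint : ∀ a : ℝ, |a| ≤ 1 / 8 → Integrable (fun ω => Real.exp (a * S ω)) μ := by
    intro a ha
    by_contra hcon
    have h0 := mgf_undef hcon
    rw [hS, h.mgf_sum_comp_sum (fun k i => (hW k i).aemeasurable) (g := fun z => z ^ 2 - 1)
      (by fun_prop) Finset.univ a, Finset.prod_eq_zero_iff] at h0
    obtain ⟨k, -, hk0⟩ := h0
    exact (mgf_pos ((hZ k).integrable_exp_mul_sq_sub_one ha)).ne' hk0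
  -- `a = 2 ^ (-15)` minimizes `256 * a ^ 2 - a / 64`, with minimum `-2 ^ (-22)`.
  have e1 := measure_ge_le_exp_mul_mgf ((Fintype.card κ : ℝ) / 64)
    (by norm_num : (0 : ℝ) ≤ 1 / 2 ^ 15) (hint _ (by rw [abs_le]; norm_num))
  have e2 := measure_le_le_exp_mul_mgf (-((Fintype.card κ : ℝ) / 64))
    (by norm_num : (-(1 / 2 ^ 15) : ℝ) ≤ 0) (hint _ (by rw [abs_le]; norm_num))
  have m1 := hmgf (1 / 2 ^ 15) (by rw [abs_le]; norm_num)
  have m2 := hmgf (-(1 / 2 ^ 15)) (by rw [abs_le]; norm_num)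
  have f1 : μ.real {ω | (Fintype.card κ : ℝ) / 64 ≤ S ω} ≤
      Real.exp (-(Fintype.card κ / 2 ^ 22)) := by
    refine e1.trans ((mul_le_mul_of_nonneg_left m1 (Real.exp_pos _).le).trans_eq ?_)
    rw [← Real.exp_add]
    congr 1
    ring
  have f2 : μ.real {ω | S ω ≤ -((Fintype.card κ : ℝ) / 64)} ≤
      Real.exp (-(Fintype.card κ / 2 ^ 22)) := by
    refine e2.trans ((mul_le_mul_of_nonneg_left m2 (Real.exp_pos _).le).trans_eq ?_)
    rw [← Real.exp_add]
    congr 1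
    ring
  have hsub : {ω | (Fintype.card κ : ℝ) / 64 ≤ |S ω|} ⊆
      {ω | (Fintype.card κ : ℝ) / 64 ≤ S ω} ∪ {ω | S ω ≤ -((Fintype.card κ : ℝ) / 64)} := by
    intro ω hω
    rcases le_abs.1 (show _ ≤ |S ω| from hω) with h | h
    · exact Or.inl h
    · exact Or.inr (by change S ω ≤ _; linarith)
  linarith [measureReal_mono (μ := μ) hsub, measureReal_union_le (μ := μ)
    {ω | (Fintype.card κ : ℝ) / 64 ≤ S ω} {ω | S ω ≤ -((Fintype.card κ : ℝ) / 64)}]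

end

/-! ### Isotropic sub-Gaussian vectors and the sample covariance -/

section
variable {Ω : Type*} [MeasurableSpace Ω] {μ : Measure Ω} {m : ℕ}
  {X : Ω → EuclideanSpace ℝ (Fin m)}

theorem IsSubGaussianOne.hasSubgaussianMGF_inner [IsProbabilityMeasure μ] (h : IsSubGaussianOne μ X)
    (v : EuclideanSpace ℝ (Fin m)) :
    HasSubgaussianMGF (fun ω => inner ℝ v (X ω)) (‖v‖₊ ^ 2) μ := by
  rcases eq_or_ne v 0 with rfl | hv
  · simp
  have hv' : ‖v‖ ≠ 0 := norm_ne_zero_iff.2 hv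
  have h1 := (h (‖v‖⁻¹ • v) (by rw [norm_smul, norm_inv, norm_norm, inv_mul_cancel₀ hv'])).const_mul
    ‖v‖
  have e1 : (fun ω => ‖v‖ * inner ℝ (‖v‖⁻¹ • v) (X ω)) = fun ω => inner ℝ v (X ω) := by
    funext ω
    rw [real_inner_smul_left, ← mul_assoc, mul_inv_cancel₀ hv', one_mul]
  rw [e1] at h1
  convert h1 using 1
  exact NNReal.eq (mul_one (‖v‖ ^ 2)).symm

theorem IsIsotropic.integral_inner_sq (h : IsIsotropic μ X) (hs : IsSubGaussianOne μ X)
    (v : EuclideanSpace ℝ (Fin m)) :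
    ∫ ω, (inner ℝ v (X ω)) ^ 2 ∂μ = ‖v‖ ^ 2 := by
  have hL : ∀ i, MemLp (fun ω => X ω i) 2 μ := by
    intro i
    have := (hs (EuclideanSpace.single i 1) (by simp)).memLp 2
    simpa [EuclideanSpace.inner_single_left] using this
  have hint : ∀ i j, Integrable (fun ω => v i * v j * (X ω i * X ω j)) μ := fun i j =>
    ((hL i).integrable_mul (hL j)).const_mul _
  have hE : ∀ i j, ∫ ω, X ω i * X ω j ∂μ = if i = j then 1 else 0 := by
    intro i j
    have := congrFun (congrFun h i) j
    rwa [Matrix.of_apply, Matrix.one_apply] at this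
  have hexp : ∀ ω, (inner ℝ v (X ω)) ^ 2 = ∑ i, ∑ j, v i * v j * (X ω i * X ω j) := by
    intro ω
    rw [PiLp.inner_apply, sq, Finset.sum_mul_sum]
    refine Finset.sum_congr rfl fun i _ => Finset.sum_congr rfl fun j _ => ?_
    simp
    ring
  simp_rw [hexp]
  rw [integral_finsetSum _ fun i _ => integrable_finsetSum _ fun j _ => hint i j]
  simp_rw [integral_finsetSum _ fun j _ => hint _ j, integral_const_mul, hE]
  rw [EuclideanSpace.norm_sq_eq]
  simp [sq]

end

theorem dotProduct_stackedPast {m : ℕ} (u : ℕ → EuclideanSpace ℝ (Fin m)) (l d : ℕ)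
    (x : Fin d × Fin m → ℝ) :
    x ⬝ᵥ stackedPast u l d =
      ∑ i : Fin d, inner ℝ (WithLp.toLp 2 fun a => x (i, a)) (u (l - i)) := by
  simp only [dotProduct, stackedPast, Fintype.sum_prod_type, PiLp.inner_apply]
  exact Finset.sum_congr rfl fun i _ => Finset.sum_congr rfl fun a _ => by simp [mul_comm]

theorem sum_nnnorm_sq_blocks {m d : ℕ} (x : EuclideanSpace ℝ (Fin d × Fin m)) :
    ∑ i : Fin d, ‖(WithLp.toLp 2 fun a => x (i, a) : EuclideanSpace ℝ (Fin m))‖₊ ^ 2 =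
      ‖x‖₊ ^ 2 := by
  apply NNReal.eq
  push_cast
  simp only [EuclideanSpace.norm_sq_eq, Fintype.sum_prod_type]

theorem isHermitian_sampleCov {m : ℕ} (u : ℕ → EuclideanSpace ℝ (Fin m)) (d T : ℕ) :
    (sampleCov u d T).IsHermitian := by
  rw [Matrix.IsHermitian, sampleCov, Matrix.conjTranspose_sum]
  refine Finset.sum_congr rfl fun l _ => ?_
  ext p q
  simp [Matrix.vecMulVec_apply, mul_comm]

theorem dotProduct_sampleCov_mulVec {m : ℕ} (u : ℕ → EuclideanSpace ℝ (Fin m)) (d T : ℕ)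
    (x : Fin d × Fin m → ℝ) :
    x ⬝ᵥ (sampleCov u d T).mulVec x =
      ∑ l ∈ Finset.range T, (x ⬝ᵥ stackedPast u (l + d) d) ^ 2 := by
  rw [sampleCov, Matrix.sum_mulVec, dotProduct_sum]
  refine Finset.sum_congr rfl fun l _ => ?_
  rw [Matrix.vecMulVec_mulVec, dotProduct_comm _ x]
  simp [dotProduct_smul, sq]

theorem dotProduct_sub_smul_one_mulVec {ι : Type*} [Fintype ι] [DecidableEq ι]
    (V : Matrix ι ι ℝ) (c : ℝ) (x : ι → ℝ) :
    x ⬝ᵥ (V - c • 1).mulVec x = x ⬝ᵥ V.mulVec x - c * (x ⬝ᵥ x) := by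
  rw [Matrix.sub_mulVec, Matrix.smul_mulVec, Matrix.one_mulVec, dotProduct_sub, dotProduct_smul,
    smul_eq_mul]

theorem posSemidef_of_abs_dotProduct_mulVec_le {ι : Type*} [Fintype ι] [DecidableEq ι]
    {V : Matrix ι ι ℝ} (hV : V.IsHermitian) {T : ℝ}
    (h : ∀ y : EuclideanSpace ℝ ι,
      |y.ofLp ⬝ᵥ (V - T • 1).mulVec y.ofLp| ≤ T / 2 * ‖y‖ ^ 2) :
    (V - ((1 / 2 : ℝ) * T) • 1).PosSemidef ∧ (((3 / 2 : ℝ) * T) • 1 - V).PosSemidef := by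
  have hone : ∀ c : ℝ, (c • (1 : Matrix ι ι ℝ)).IsHermitian := fun c => by
    simp [Matrix.IsHermitian]
  have key : ∀ x : ι → ℝ, |x ⬝ᵥ V.mulVec x - T * (x ⬝ᵥ x)| ≤ T / 2 * (x ⬝ᵥ x) := by
    intro x
    have := h (WithLp.toLp 2 x)
    rw [dotProduct_sub_smul_one_mulVec, EuclideanSpace.norm_sq_eq] at this
    simpa [dotProduct, sq] using this
  constructor
  · refine Matrix.PosSemidef.of_dotProduct_mulVec_nonneg (hV.sub (hone _)) fun x => ?_
    rw [star_trivial, dotProduct_sub_smul_one_mulVec]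
    linarith [(abs_le.1 (key x)).1]
  · refine Matrix.PosSemidef.of_dotProduct_mulVec_nonneg ((hone _).sub hV) fun x => ?_
    have e := dotProduct_sub_smul_one_mulVec V (3 / 2 * T) x
    rw [star_trivial, ← neg_sub, Matrix.neg_mulVec, dotProduct_neg, e]
    linarith [(abs_le.1 (key x)).2]

/-! ### Residue classes and the union bound -/

theorem measureReal_residue_class_le {Ω : Type*} [MeasurableSpace Ω] (μ : Measure Ω)
    [IsProbabilityMeasure μ] {m d T : ℕ} (U : ℕ → Ω → EuclideanSpace ℝ (Fin m))
    (hind : iIndepFun (fun t : Set.Ico 1 (T + d) => U t) μ)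
    (hiso : ∀ t ∈ Set.Ico 1 (T + d), IsIsotropic μ (U t))
    (hsub : ∀ t ∈ Set.Ico 1 (T + d), IsSubGaussianOne μ (U t))
    (x : EuclideanSpace ℝ (Fin d × Fin m)) (hx : ‖x‖ = 1) (r : ℕ) :
    μ.real {ω | (((Finset.range T).filter (· % d = r)).card : ℝ) / 64 ≤
        |∑ l ∈ (Finset.range T).filter (· % d = r),
          ((x.ofLp ⬝ᵥ stackedPast (fun t => U t ω) (l + d) d) ^ 2 - 1)|} ≤
      2 * Real.exp (-(((Finset.range T).filter (· % d = r)).card / 2 ^ 22)) := by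
  set s := (Finset.range T).filter (· % d = r) with hs
  let xb : Fin d → EuclideanSpace ℝ (Fin m) := fun i => WithLp.toLp 2 fun a => x (i, a)
  have hmem : ∀ (l : s) (i : Fin d), (l : ℕ) + d - i ∈ Set.Ico 1 (T + d) := by
    rintro ⟨l, hl⟩ i
    rw [hs, Finset.mem_filter, Finset.mem_range] at hl
    have := i.2
    constructor <;> dsimp only <;> omega
  let g : s × Fin d → Set.Ico 1 (T + d) := fun p => ⟨p.1 + d - p.2, hmem p.1 p.2⟩
  -- Distinct members of a class differ by at least `d`, while the offsets `i` range over fewer than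
  -- `d` steps, so no input occurs twice.
  have hg : Function.Injective g := by
    rintro ⟨⟨l, hl⟩, i, hi⟩ ⟨⟨l', hl'⟩, i', hi'⟩ h
    rw [hs, Finset.mem_filter] at hl hl'
    have h1 : l + d - i = l' + d - i' := congrArg Subtype.val h
    have h2 : l = l' := by
      have hq : l / d = l' / d := by
        have a1 := Nat.div_add_mod l d
        have a2 := Nat.div_add_mod l' d
        rw [hl.2] at a1
        rw [hl'.2] at a2
        rcases lt_trichotomy (l / d) (l' / d) with hlt | heq | hgt
        · have := Nat.mul_le_mul_left d (Nat.succ_le_of_lt hlt)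
          rw [Nat.mul_succ] at this
          omega
        · exact heq
        · have := Nat.mul_le_mul_left d (Nat.succ_le_of_lt hgt)
          rw [Nat.mul_succ] at this
          omega
      rw [← Nat.div_add_mod l d, ← Nat.div_add_mod l' d, hq, hl.2, hl'.2]
    subst h2
    have h3 : i = i' := by omega
    subst h3
    rfl
  have hW := (hind.precomp hg).comp (fun p v => inner ℝ (xb p.2) v)
    fun p => by fun_prop
  have key := measureReal_card_div_le_abs_sum_sq_sub_one_le (μ := μ) (κ := s) (ι := Fin d)
    (W := fun l i ω => inner ℝ (xb i) (U (l + d - i) ω)) (c := fun i => ‖xb i‖₊ ^ 2) hW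
    (fun l i => (hsub _ (hmem l i)).hasSubgaussianMGF_inner _)
    (fun l i => by
      rw [(hiso _ (hmem l i)).integral_inner_sq (hsub _ (hmem l i))]
      simp)
    (by
      rw [sum_nnnorm_sq_blocks]
      apply NNReal.eq
      simp [hx])
  rw [Fintype.card_coe] at key
  simp only [dotProduct_stackedPast]
  refine le_of_eq_of_le (congrArg μ.real ?_) key
  ext ω
  rw [Set.mem_ofPred_eq, Set.mem_ofPred_eq, ← Finset.sum_coe_sort s]

theorem div_sub_one_le_card_residue_class {d r : ℕ} (T : ℕ) (hr : r < d) :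
    (T : ℝ) / d - 1 ≤ ((Finset.range T).filter (· % d = r)).card := by
  have hd : 0 < d := by omega
  have h := Nat.count_modEq_card T hd r
  rw [Nat.count_eq_card_filter_range] at h
  simp only [Nat.ModEq, Nat.mod_eq_of_lt hr] at h
  rw [h]
  have h1 : T / d ≤ T / d + if r < T % d then 1 else 0 := Nat.le_add_right _ _
  refine le_trans ?_ (Nat.cast_le.2 h1)
  have h2 := Nat.lt_div_mul_add hd (a := T)
  have h3 : (T : ℝ) < (T / d : ℕ) * d + d := by exact_mod_cast h2
  rw [sub_le_iff_le_add, div_le_iff₀ (by exact_mod_cast hd)]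
  linarith

/-- The term `d * log (2 / δ)` pays for the net, since `log (2 / δ) ≥ log 2 > 0.69`; the other
logarithm pays for the factor `2 * d / δ`. With `C = 2 ^ 24` the exponent `n / 2 ^ 22` is at least
`4 * (0.69 * d * m + 2 * L) - 2 ^ (-22)`, which exceeds `2 * d * m + L`. -/
theorem card_mul_exp_le_of_sampleThreshold_lt {m d T : ℕ} {δ n : ℝ} (hm : 1 ≤ m) (hd : 1 ≤ d)
    (hδ : 0 < δ) (hδ1 : δ < 1) (hT : sampleThreshold (2 ^ 24) m d δ < T)
    (hn : (T : ℝ) / d - 1 ≤ n) :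
    5 ^ (d * m) * (d * (2 * Real.exp (-(n / 2 ^ 22)))) ≤ δ := by
  have hm' : (1 : ℝ) ≤ m := by exact_mod_cast hm
  have hd' : (1 : ℝ) ≤ d := by exact_mod_cast hd
  have hdpos : (0 : ℝ) < d := by linarith
  have hlog2 := Real.log_two_gt_d9
  set L := Real.log (2 * d / δ) with hL
  have hL0 : 0 ≤ L := Real.log_nonneg (by rw [le_div_iff₀ hδ]; linarith)
  have l1 : Real.log 2 ≤ Real.log (2 / δ) :=
    Real.log_le_log (by norm_num) (by rw [le_div_iff₀ hδ]; linarith)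
  have l2 : L ≤ Real.log (8 * d * m / δ) := by
    refine Real.log_le_log (by positivity) ?_
    refine div_le_div_of_nonneg_right ?_ hδ.le
    nlinarith
  have hTd : 2 ^ 24 * (0.69 * (d * m) + 2 * L) < (T : ℝ) / d := by
    rw [lt_div_iff₀ hdpos]
    refine lt_of_le_of_lt ?_ hT
    rw [sampleThreshold]
    have h1 : (0.69 : ℝ) ≤ Real.log (2 / δ) := by linarith
    have h2 : d * m * 0.69 ≤ d * m * Real.log (2 / δ) := by gcongr
    have h3 : 1 * (2 * L) ≤ m * (2 * Real.log (8 * d * m / δ)) := by gcongr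
    have h4 : 0.69 * (d * m) + 2 * L ≤ 
        m * (d * Real.log (2 / δ) + 2 * Real.log (8 * d * m / δ)) := by linarith
    have h5 := mul_le_mul_of_nonneg_left h4 (by positivity : (0 : ℝ) ≤ 2 ^ 24 * d)
    linarith
  have hlog5 : Real.log 5 ≤ 2 := by
    rw [Real.log_le_iff_le_exp (by norm_num), show (2 : ℝ) = 1 + 1 by norm_num, Real.exp_add]
    nlinarith [Real.exp_one_gt_d9]
  have hdm : (1 : ℝ) ≤ d * m := by nlinarith
  have hexp : (d * m : ℝ) * Real.log 5 + L ≤ n / 2 ^ 22 := by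
    rw [le_div_iff₀ (by norm_num)]
    have : (d * m : ℝ) * Real.log 5 ≤ d * m * 2 := by gcongr
    nlinarith
  have e5 : (5 : ℝ) ^ (d * m) = Real.exp (d * m * Real.log 5) := by
    rw [← Nat.cast_mul, Real.exp_nat_mul, Real.exp_log (by norm_num)]
  have eL : 2 * (d : ℝ) = δ * Real.exp L := by
    rw [hL, Real.exp_log (by positivity)]
    field_simp
  calc (5 : ℝ) ^ (d * m) * (d * (2 * Real.exp (-(n / 2 ^ 22))))
      = (2 * d) * (5 ^ (d * m) * Real.exp (-(n / 2 ^ 22))) := by ring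
    _ = δ * Real.exp (L + d * m * Real.log 5 + -(n / 2 ^ 22)) := by
        rw [eL, e5, Real.exp_add, Real.exp_add]; ring
    _ ≤ δ * 1 := by
        gcongr
        exact Real.exp_le_one_iff.2 (by linarith)
    _ = δ := mul_one δ

theorem mainTheorem4 :
    ∃ C : ℝ, 0 < C ∧
      ∀ (m d T : ℕ) (δ : ℝ), 1 ≤ m → 1 ≤ d → 0 < δ → δ < 1 →
        sampleThreshold C m d δ < (T : ℝ) →
        ∀ {Ω : Type*} [MeasurableSpace Ω] (μ : Measure Ω) [IsProbabilityMeasure μ]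
          (U : ℕ → Ω → EuclideanSpace ℝ (Fin m)),
          iIndepFun (fun t : Set.Ico 1 (T + d) => U t) μ →
          (∀ s ∈ Set.Ico 1 (T + d), ∀ t ∈ Set.Ico 1 (T + d), IdentDistrib (U s) (U t) μ μ) →
          (∀ t ∈ Set.Ico 1 (T + d), IsIsotropic μ (U t)) →
          (∀ t ∈ Set.Ico 1 (T + d), IsSubGaussianOne μ (U t)) →
          1 - δ ≤ μ.real {ω |
            (sampleCov (fun t => U t ω) d T - ((1 / 2 : ℝ) * T) • 1).PosSemidef ∧
            (((3 / 2 : ℝ) * T) • 1 - sampleCov (fun t => U t ω) d T).PosSemidef} := by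
  refine ⟨2 ^ 24, by norm_num, ?_⟩
  intro m d T δ hm hd hδ hδ1 hT Ω _ μ _ U hind _ hiso hsub
  obtain ⟨N, hN1, hNcard, hnet⟩ := exists_half_net_sphere (EuclideanSpace ℝ (Fin d × Fin m))
  rw [finrank_euclideanSpace, Fintype.card_prod, Fintype.card_fin, Fintype.card_fin] at hNcard
  let cls : ℕ → Finset ℕ := fun r => (Finset.range T).filter (· % d = r)
  let dev : EuclideanSpace ℝ (Fin d × Fin m) → ℕ → Ω → ℝ := fun x l ω =>
    (x.ofLp ⬝ᵥ stackedPast (fun t => U t ω) (l + d) d) ^ 2 - 1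
  let bad : EuclideanSpace ℝ (Fin d × Fin m) → ℕ → Set Ω := fun x r =>
    {ω | ((cls r).card : ℝ) / 64 ≤ |∑ l ∈ cls r, dev x l ω|}
  let Bad : Set Ω := ⋃ x ∈ N, ⋃ r ∈ Finset.range d, bad x r
  have hmaps : ∀ l ∈ Finset.range T, l % d ∈ Finset.range d := fun l _ =>
    Finset.mem_range.2 (Nat.mod_lt _ (by omega))
  have hBad : μ.real Bad ≤ δ := by
    let b : ℝ := 2 * Real.exp (-(((T : ℝ) / d - 1) / 2 ^ 22))
    have hb : ∀ x ∈ N, ∀ r ∈ Finset.range d, μ.real (bad x r) ≤ b := by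
      intro x hx r hr
      refine (measureReal_residue_class_le μ U hind hiso hsub x (hN1 x hx) r).trans ?_
      have := div_sub_one_le_card_residue_class T (Finset.mem_range.1 hr)
      dsimp only [b]
      gcongr
    have h1 : ∀ x ∈ N, μ.real (⋃ r ∈ Finset.range d, bad x r) ≤ d * b := by
      intro x hx
      refine (measureReal_biUnion_finset_le _ _).trans ((Finset.sum_le_sum (hb x hx)).trans_eq ?_)
      simp
    calc μ.real Bad ≤ N.card * (d * b) := by
          refine (measureReal_biUnion_finset_le _ _).trans ((Finset.sum_le_sum h1).trans_eq ?_)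
          simp
      _ ≤ 5 ^ (d * m) * (d * b) := by
          gcongr
          exact_mod_cast hNcard
      _ ≤ δ := card_mul_exp_le_of_sampleThreshold_lt hm hd hδ hδ1 hT le_rfl
  have hgood : Badᶜ ⊆ {ω |
      (sampleCov (fun t => U t ω) d T - ((1 / 2 : ℝ) * T) • 1).PosSemidef ∧
      (((3 / 2 : ℝ) * T) • 1 - sampleCov (fun t => U t ω) d T).PosSemidef} := by
    intro ω hω
    have hω' : ∀ x ∈ N, ∀ r ∈ Finset.range d,
        |∑ l ∈ cls r, dev x l ω| ≤ ((cls r).card : ℝ) / 64 := by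
      intro x hx r hr
      by_contra hcon
      exact hω (Set.mem_biUnion hx (Set.mem_biUnion hr (not_le.1 hcon).le))
    refine posSemidef_of_abs_dotProduct_mulVec_le (isHermitian_sampleCov _ d T) fun y => ?_
    refine (abs_dotProduct_mulVec_le_of_half_net _ N hN1 hnet (τ := (T : ℝ) / 64)
      (fun x hx => ?_) y).trans_eq (by ring)
    have hxx : x.ofLp ⬝ᵥ x.ofLp = 1 := by
      have := EuclideanSpace.norm_sq_eq x
      rw [hN1 x hx] at this
      simpa [dotProduct, sq] using this.symm
    -- The class deviations are at most `1 / 64` of the class sizes, and these sizes add up to `T`.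
    have hsum : x.ofLp ⬝ᵥ (sampleCov (fun t => U t ω) d T - (T : ℝ) • 1).mulVec x.ofLp =
        ∑ r ∈ Finset.range d, ∑ l ∈ cls r, dev x l ω := by
      rw [Finset.sum_fiberwise_of_maps_to hmaps, dotProduct_sub_smul_one_mulVec,
        dotProduct_sampleCov_mulVec, hxx, Finset.sum_sub_distrib]
      simp
    rw [hsum]
    refine (Finset.abs_sum_le_sum_abs _ _).trans ((Finset.sum_le_sum (hω' x hx)).trans_eq ?_)
    rw [← Finset.sum_div, ← Nat.cast_sum, ← Finset.card_eq_sum_card_fiberwise hmaps,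
      Finset.card_range]
  have hcompl : 1 ≤ μ.real Bad + μ.real Badᶜ := by
    have := measureReal_union_le (μ := μ) Bad Badᶜ
    rwa [Set.union_compl_self, probReal_univ] at this
  linarith [measureReal_mono (μ := μ) hgood]
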